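/- Let $F=\mathbb R$ or $F=\mathbb C$ and let $A=F\langle x,x^*\rangle$ be the free $*$-algebra on $x=(x_1,\dots,x_g)$: its elements are finite $F$-linear combinations of words in the letters $x_1,\dots,x_g,x_1^*,\dots,x_g^*$, and its involution conjugates coefficients, reverses words and exchanges $x_j$ with $x_j^*$. A $*$-representation of $A$ on a pre-Hilbert space $V$ over $F$ (an inner product space, not necessarily complete) is a unital $F$-algebra homomorphism $\pi$ from $A$ to the linear operators on $V$ with $\langle \pi(a)v,w\rangle=\langle v,\pi(a^*)w\rangle$ for all $a\in A$ and $v,w\in V$. Let $\mathcal R$ be the class of all $*$-representations of $A$ and $\Pi$ the class of those on finite-dimensional spaces. For a class $\mathcal C$ of $*$-representations, a $\mathcal C$-point is a pair $(\pi,v)$ with $\pi\in\mathcal C$ and $v\in V_\pi$, where $V_\pi$ is the space of $\pi$. For a left ideal $I$ of $A$ put $$\sqrt[\mathcal C]{I}=\{a\in A:\ \pi(a)v=0 \text{ for every } \mathcal C\text{-point }(\pi,v)\text{ such that }\pi(s)v=0\text{ for all }s\in I\}.$$ The ideal $I$ has the left Nullstellensatz property for $\mathcal C$-points if $\sqrt[\mathcal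 C]{I}=I$. A left ideal $I$ is real if, whenever $a_1,\dots,a_r\in A$ satisfy $\sum_{i=1}^r a_i^*a_i\in I+I^*$, all of $a_1,\dots,a_r$ lie in $I$. Let $\operatorname{rr}(I)$ be the intersection of all real left ideals that contain $I$; it is the smallest real left ideal containing $I$. Theorem. Let $I$ be a finitely generated left ideal of $A$. Then $I$ has the left Nullstellensatz property for $\Pi$-points if and only if $I$ is real. Moreover $$I\subseteq \operatorname{rr}(I)=\sqrt[\mathcal R]{I}=\sqrt[\Pi]{I}.$$ -/

import Mathlib

universe u

/-! ## The free `*`-algebra -/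

/-- Words in the letters `x₁, …, x_g, x₁*, …, x_g*`: the letter `Sum.inl j` is `x_j` and the
letter `Sum.inr j` is `x_j*`. -/
abbrev StarWord (g : ℕ) : Type := FreeMonoid (Fin g ⊕ Fin g)

namespace StarWord

variable {g : ℕ}

/-- The involution on words: reverse the word and exchange `x_j` and `x_j*` in it. -/
def inv (w : StarWord g) : StarWord g :=
  FreeMonoid.ofList ((FreeMonoid.toList w).map Sum.swap).reverse

theorem inv_inv (w : StarWord g) : inv (inv w) = w := by
  simp [inv, List.map_reverse]

theorem inv_mul (v w : StarWord g) : inv (v * w) = inv w * inv v := by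
  simp [inv, FreeMonoid.ofList_append]

theorem inv_one : inv (1 : StarWord g) = 1 := rfl

theorem inv_of (l : Fin g ⊕ Fin g) : inv (FreeMonoid.of l) = FreeMonoid.of l.swap := rfl

end StarWord

/-- The free `*`-algebra `F⟨x, x*⟩` on `x = (x₁, …, x_g)`: finite `F`-linear combinations of
words in the letters `x_j` and `x_j*`, multiplied by concatenation of words. -/
abbrev FreeStarAlgebra (F : Type*) [RCLike F] (g : ℕ) : Type _ :=
  MonoidAlgebra F (StarWord g)

namespace FreeStarAlgebra

variable {F : Type*} [RCLike F] {g : ℕ}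

/-- The generator `x_j`. -/
noncomputable def x (j : Fin g) : FreeStarAlgebra F g :=
  MonoidAlgebra.single (FreeMonoid.of (Sum.inl j)) 1

/-- The generator `x_j*`. -/
noncomputable def xStar (j : Fin g) : FreeStarAlgebra F g :=
  MonoidAlgebra.single (FreeMonoid.of (Sum.inr j)) 1

/-- The conjugate linear map with `(∑ c_w w)* = ∑ (conj c_w) w*`. -/
noncomputable instance instStar : Star (FreeStarAlgebra F g) where
  star p := p.coeff.sum fun w c => MonoidAlgebra.single w.inv (star c)

theorem star_single (w : StarWord g) (c : F) :
    star (MonoidAlgebra.single w c : FreeStarAlgebra F g)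
      = MonoidAlgebra.single w.inv (star c) := by
  change Finsupp.sum _ _ = _
  simp

theorem star_add' (p q : FreeStarAlgebra F g) : star (p + q) = star p + star q := by
  change Finsupp.sum (p.coeff + q.coeff) _ = Finsupp.sum p.coeff _ + Finsupp.sum q.coeff _
  refine Finsupp.sum_add_index' (fun w => ?_) fun w c d => ?_
  · simp
  · simp [MonoidAlgebra.single_add]

/-- `F⟨x, x*⟩` is a `*`-ring. -/
noncomputable instance instStarRing : StarRing (FreeStarAlgebra F g) where
  star_involutive p := by
    induction p using MonoidAlgebra.induction_linear with
    | zero => change star (Finsupp.sum 0 _) = 0; rw [Finsupp.sum_zero_index]; rfl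
    | add p q hp hq => rw [star_add', star_add', hp, hq]
    | single w c => rw [star_single, star_single, StarWord.inv_inv, star_star]
  star_add := star_add'
  star_mul p q := by
    have h0 : star (0 : FreeStarAlgebra F g) = 0 := Finsupp.sum_zero_index
    induction p using MonoidAlgebra.induction_linear with
    | zero => rw [zero_mul, h0, mul_zero]
    | add p p' hp hp' => rw [add_mul, star_add', star_add', hp, hp', mul_add]
    | single v c =>
      induction q using MonoidAlgebra.induction_linear with
      | zero => rw [mul_zero, h0, zero_mul]
      | add q q' hq hq' => rw [mul_add, star_add', star_add', hq, hq', add_mul]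
      | single w d =>
        rw [MonoidAlgebra.single_mul_single, star_single, star_single, star_single,
          MonoidAlgebra.single_mul_single, StarWord.inv_mul, star_mul]

/-- The involution of `F⟨x, x*⟩` is conjugate linear over `F`. -/
instance instStarModule : StarModule F (FreeStarAlgebra F g) where
  star_smul c p := by
    induction p using MonoidAlgebra.induction_linear with
    | zero => simp
    | add p q hp hq => rw [smul_add, star_add, star_add, smul_add, hp, hq]
    | single w d =>
      rw [MonoidAlgebra.smul_single, star_single, star_single, MonoidAlgebra.smul_single,
        smul_eq_mul, star_mul', smul_eq_mul]

theorem star_x (j : Fin g) : star (x j : FreeStarAlgebra F g) = xStar j := by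
  simp [x, xStar, star_single, StarWord.inv_of]

end FreeStarAlgebra

/-! ## `*`-representations, points, zero sets and radicals -/

/-- A unital `*`-representation of the `*`-algebra `A` on a pre-Hilbert space `V` (an inner
product space over `F`, not assumed to be complete) by linear operators that are defined on
all of `V` (and not assumed to be bounded). -/
structure StarRep (F : Type*) [RCLike F] (A : Type*) [Ring A] [Algebra F A] [StarRing A] where
  /-- The underlying space. -/
  V : Type u
  [normedAddCommGroup : NormedAddCommGroup V]
  [innerProductSpace : InnerProductSpace F V]
  /-- The action of `A`. -/
  toAlgHom : A →ₐ[F] Module.End F V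
  inner_apply_left : ∀ (a : A) (v w : V),
    inner F (toAlgHom a v) w = inner F v (toAlgHom (star a) w)

attribute [instance] StarRep.normedAddCommGroup StarRep.innerProductSpace

section Radicals

variable {F : Type*} [RCLike F] {A : Type*} [Ring A] [Algebra F A] [StarRing A]

variable (F A) in
/-- The class of all `*`-representations of `A`. -/
def allReps : Set (StarRep.{u} F A) := Set.univ

variable (F A) in
/-- The class of all finite-dimensional `*`-representations of `A`. -/
def finDimReps : Set (StarRep.{u} F A) := {π | FiniteDimensional F π.V}

/-- The zero set of `S`: all pairs `(π, v)` with `π` in the class `C` and `v` in the space of `π`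
such that `π(s) v = 0` for every `s ∈ S`. -/
def zeroSet (C : Set (StarRep.{u} F A)) (S : Set A) : Set (Σ π : StarRep.{u} F A, π.V) :=
  {P | P.1 ∈ C ∧ ∀ s ∈ S, P.1.toAlgHom s P.2 = 0}

/-- The left ideal of all `a` with `π(a) v = 0` for every point `(π, v)` of `T`.
(For a noncommutative ring, `Ideal` is the type of left ideals.) -/
def vanishingIdeal (T : Set (Σ π : StarRep.{u} F A, π.V)) : Ideal A where
  carrier := {a | ∀ P ∈ T, P.1.toAlgHom a P.2 = 0}
  zero_mem' P _ := by simp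
  add_mem' {a b} ha hb P hP := by simp [ha P hP, hb P hP]
  smul_mem' c a ha P hP := by simp [ha P hP]

/-- The radical of a left ideal for a class `C` of `*`-representations. -/
def repRadical (C : Set (StarRep.{u} F A)) (I : Ideal A) : Ideal A :=
  vanishingIdeal (zeroSet C (I : Set A))

/-- `I` has the left Nullstellensatz property for `C`-points. -/
def HasLeftNullstellensatz (C : Set (StarRep.{u} F A)) (I : Ideal A) : Prop :=
  repRadical C I = I

end Radicals

/-! ## Real left ideals -/

section RealIdeals

variable {A : Type*} [Ring A] [StarRing A]

/-- A left ideal `I` is real if `∑ aᵢ* aᵢ ∈ I + I*` implies that every `aᵢ` lies in `I`. -/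
def IsRealLeftIdeal (I : Ideal A) : Prop :=
  ∀ (r : ℕ) (a : Fin r → A),
    (∃ b ∈ I, ∃ c ∈ I, ∑ i, star (a i) * a i = b + star c) → ∀ i, a i ∈ I

/-- The real radical of `J`: the intersection of all real left ideals that contain `J`. -/
def realRadical (J : Ideal A) : Ideal A :=
  sInf {I : Ideal A | J ≤ I ∧ IsRealLeftIdeal I}

/-- The real radical of `J` is the smallest real left ideal that contains `J`. -/
theorem isLeast_realRadical (J : Ideal A) :
    IsLeast {I : Ideal A | J ≤ I ∧ IsRealLeftIdeal I} (realRadical J) := by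
  refine ⟨⟨le_sInf fun I hI => hI.1, ?_⟩, fun I hI => sInf_le hI⟩
  rintro r a ⟨b, hb, c, hc, h⟩ i
  refine Submodule.mem_sInf.2 fun I hI => ?_
  exact hI.2 r a ⟨b, sInf_le hI hb, c, sInf_le hI hc, h⟩ i

end RealIdeals

/-! Vanishing ideals of points are real, because applying `∑ aᵢ* aᵢ ∈ I + I*` at a vector and
pairing with it gives `∑ ‖π(aᵢ)v‖² = 0`. Hence the real radical lies in the radical over all
representations, which lies in the one over finite-dimensional representations. Only the return
inclusion needs work.

It rests on a truncated GNS construction. For a real left ideal `J` and a finite-dimensional `W`, no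
sum of squares from `W` falls in `J + J*` unless its terms lie in `J`. Compactness and Hahn-Banach
then give a hermitian functional that is zero on squares from `J` and positive on squares from `W`
outside `J`. Take `W` to be the elements of degree at most `k + 1`. The functional makes `W/(W ∩ J)`
a finite-dimensional Hilbert space, on which left multiplication by a letter is defined only on
classes of degree at most `k`. As the algebra is free, any operators extending the partial maps of
the `x_j` give a representation, provided their adjoints extend those of the `x_j*`. The class of
`1` is then annihilated, up to degree `k + 1`, exactly by `J`. Finite generation lets one `k` cover
all generators and the element under test. -/

/-! ### Separation of squares from zero -/

/-- In a finite-dimensional space the convex hull of a compact set is compact. -/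
theorem IsCompact.convexHull_of_finiteDimensional {E : Type*} [NormedAddCommGroup E]
    [NormedSpace ℝ E] [FiniteDimensional ℝ E] {s : Set E} (hs : IsCompact s) :
    IsCompact (convexHull ℝ s) := by
  let f (m : ℕ) : (Fin m → ℝ) × (Fin m → E) → E := fun p => ∑ i, p.1 i • p.2 i
  have hf (m : ℕ) : Continuous (f m) := by
    refine continuous_finsetSum _ fun i _ => ?_
    fun_prop
  -- Carathéodory: `finrank + 1` points suffice, so the hull is a finite union of continuous images
  -- of compact sets.
  have key : convexHull ℝ s = ⋃ m ∈ Set.Iic (Module.finrank ℝ E + 1),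
      f m '' (stdSimplex ℝ (Fin m) ×ˢ Set.univ.pi fun _ => s) := by
    apply Set.Subset.antisymm
    · intro x hx
      obtain ⟨ι, _, z, w, hz, hind, hw, hw1, rfl⟩ := eq_pos_convex_span_of_mem_convexHull hx
      let e := (Fintype.equivFin ι).symm
      refine Set.mem_biUnion (x := Fintype.card ι)
        (hind.card_le_finrank_succ.trans
          (Nat.succ_le_succ (Submodule.finrank_le _))) ?_
      refine ⟨(w ∘ e, z ∘ e), ⟨⟨fun i => (hw _).le, ?_⟩, fun i _ => hz ⟨_, rfl⟩⟩, ?_⟩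
      · exact (Equiv.sum_comp e w).trans hw1
      · exact Equiv.sum_comp e fun i => w i • z i
    · refine Set.iUnion₂_subset fun m _ => ?_
      rintro _ ⟨⟨w, z⟩, ⟨hw, hz⟩, rfl⟩
      exact mem_convexHull_of_exists_fintype w z hw.1 hw.2 (fun i => hz i trivial) rfl
  rw [key]
  exact (Set.finite_Iic _).isCompact_biUnion fun m _ =>
    ((isCompact_stdSimplex _ _).prod (isCompact_univ_pi fun _ => hs)).image (hf m)

/-- If no nontrivial sum of "squares" `b v v` vanishes, then some linear functional is strictly
positive on all nonzero squares. Version for normed spaces and definite squares. -/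
theorem exists_dual_pos_of_sum_ne_zero_aux {E D : Type*}
    [NormedAddCommGroup E] [NormedSpace ℝ E] [FiniteDimensional ℝ E]
    [NormedAddCommGroup D] [NormedSpace ℝ D] [FiniteDimensional ℝ D]
    (b : E →ₗ[ℝ] E →ₗ[ℝ] D)
    (hb : ∀ (r : ℕ) (v : Fin r → E), ∑ i, b (v i) (v i) = 0 → ∀ i, v i = 0) :
    ∃ L : D →ₗ[ℝ] ℝ, ∀ v, v ≠ 0 → 0 < L (b v v) := by
  have hcont : Continuous fun v => b v v := by
    let b' : E →ₗ[ℝ] E →L[ℝ] D := LinearMap.toContinuousLinearMap.toLinearMap ∘ₗ b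
    have h1 : Continuous fun v => b' v := b'.continuous_of_finiteDimensional
    exact h1.clm_apply continuous_id
  let S : Set D := (fun v => b v v) '' Metric.sphere 0 1
  have hK : IsCompact (convexHull ℝ S) :=
    ((isCompact_sphere 0 1).image hcont).convexHull_of_finiteDimensional
  have h0 : (0 : D) ∉ convexHull ℝ S := by
    intro h
    obtain ⟨ι, _, w, z, hw, hw1, hz, h0⟩ := mem_convexHull_iff_exists_fintype.1 h
    choose v hv hvz using hz
    let e := (Fintype.equivFin ι).symm
    -- Square roots of the weights turn a convex combination of squares into a plain sum of squares.
    have hsum := hb _ (fun i => √(w (e i)) • v (e i)) (by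
      rw [← h0, ← Equiv.sum_comp e]
      refine Finset.sum_congr rfl fun i _ => ?_
      simp only [map_smul, LinearMap.smul_apply, smul_smul, Real.mul_self_sqrt (hw _), ← hvz])
    have hw0 : ∀ i, w i = 0 := by
      intro i
      have h := hsum (e.symm i)
      rw [e.apply_symm_apply] at h
      rcases smul_eq_zero.1 h with h | h
      · exact (Real.sqrt_eq_zero (hw i)).1 h
      · have := hv i
        simp [h] at this
    simp [hw0] at hw1
  obtain ⟨L, u, hu, hL⟩ := geometric_hahn_banach_point_closed (convex_convexHull ℝ S)
    hK.isClosed h0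
  refine ⟨L.toLinearMap, fun v hv => ?_⟩
  have hn : ‖v‖ ≠ 0 := norm_ne_zero_iff.2 hv
  have h1 : 0 < L (b (‖v‖⁻¹ • v) (‖v‖⁻¹ • v)) := by
    have := hL _ (subset_convexHull ℝ S ⟨‖v‖⁻¹ • v, by simp [norm_smul, hn], rfl⟩)
    rw [map_zero] at hu
    exact hu.trans this
  simp only [map_smul, LinearMap.smul_apply, smul_eq_mul, ← mul_assoc] at h1
  exact pos_of_mul_pos_right h1 (by positivity)

/-- If sums of "squares" `b v v` vanish only when all terms come from the subspace `N`,
then some linear functional is strictly positive on all squares outside `N`. -/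
theorem exists_dual_pos_of_sum_ne_zero {W Q : Type*} [AddCommGroup W] [Module ℝ W]
    [FiniteDimensional ℝ W] [AddCommGroup Q] [Module ℝ Q] (b : W →ₗ[ℝ] W →ₗ[ℝ] Q)
    (N : Submodule ℝ W) (hl : ∀ n ∈ N, ∀ w, b n w = 0) (hr : ∀ n ∈ N, ∀ w, b w n = 0)
    (hb : ∀ (r : ℕ) (v : Fin r → W), ∑ i, b (v i) (v i) = 0 → ∀ i, v i ∈ N) :
    ∃ L : Q →ₗ[ℝ] ℝ, ∀ v, v ∉ N → 0 < L (b v v) := by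
  -- Squares are definite on a complement of `N`. `Q` may be infinite-dimensional, so it is replaced
  -- by the span of the values of `b`, and the functional is extended at the end.
  obtain ⟨C, hC⟩ := N.exists_isCompl
  let D : Submodule ℝ Q := LinearMap.range (TensorProduct.lift b)
  let φ := (Module.finBasis ℝ C).equivFun.symm
  let ψ := (Module.finBasis ℝ D).equivFun
  let b' : W →ₗ[ℝ] W →ₗ[ℝ] D :=
    TensorProduct.curry (TensorProduct.lift b).rangeRestrict
  have hb' (v w : W) : (b' v w : Q) = b v w := by simp [b']
  let c := (b'.compl₁₂ (C.subtype ∘ₗ φ.toLinearMap) (C.subtype ∘ₗ φ.toLinearMap)).compr₂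
    ψ.toLinearMap
  have hc (v w) : c v w = ψ (b' (φ v) (φ w)) := rfl
  obtain ⟨L, hL⟩ := exists_dual_pos_of_sum_ne_zero_aux c (by
    intro r v h i
    have h1 : ∑ i, b (φ (v i)) (φ (v i)) = 0 := by
      simp only [hc, ← map_sum] at h
      have := congrArg (Subtype.val) (ψ.map_eq_zero_iff.1 h)
      simpa [hb'] using this
    have h2 := hb r (fun i => φ (v i)) h1 i
    have h3 := Submodule.disjoint_def.1 hC.disjoint _ h2 (φ (v i)).2
    simpa using h3)
  obtain ⟨L', hL'⟩ := (L ∘ₗ ψ.toLinearMap).exists_extend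
  refine ⟨L', fun v hv => ?_⟩
  obtain ⟨n, hn, d, hd, rfl⟩ := Submodule.mem_sup.1 (hC.sup_eq_top ▸ Submodule.mem_top (x := v))
  have hd0 : d ≠ 0 := by
    rintro rfl
    exact hv (by simpa using hn)
  have h := hL (φ.symm ⟨d, hd⟩) (by simpa using hd0)
  have h4 : b (n + d) (n + d) = b d d := by simp [hl n hn, hr n hn]
  have h5 := LinearMap.congr_fun hL' (b' d d)
  simp only [hc, LinearEquiv.apply_symm_apply] at h
  simp only [LinearMap.comp_apply, Submodule.subtype_apply, LinearEquiv.coe_coe, hb'] at h5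
  rw [h4, h5]
  exact h

/-! ### Hilbert space tools -/

/-- A positive semidefinite Hermitian form on a finite-dimensional space is the pullback of the
inner product of a Euclidean space. -/
theorem PreInnerProductSpace.Core.exists_toEuclideanSpace {F : Type*} [RCLike F] {W : Type*}
    [AddCommGroup W] [Module F W] [FiniteDimensional F W] (c : PreInnerProductSpace.Core F W) :
    ∃ (n : ℕ) (ρ : W →ₗ[F] EuclideanSpace F (ULift.{u} (Fin n))),
      ∀ v w, inner F (ρ v) (ρ w) = c.inner v w := by
  let : SeminormedAddCommGroup W := InnerProductSpace.Core.toSeminormedAddCommGroup (𝕜 := F)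
  let : InnerProductSpace F W := InnerProductSpace.ofCore c
  let mk : W →ₗ[F] SeparationQuotient W := (SeparationQuotient.mkCLM F W).toLinearMap
  have : FiniteDimensional F (SeparationQuotient W) :=
    Module.Finite.of_surjective mk SeparationQuotient.surjective_mk
  let o := (stdOrthonormalBasis F (SeparationQuotient W)).reindex Equiv.ulift.{u}.symm
  exact ⟨_, o.repr.toLinearEquiv.toLinearMap ∘ₗ mk, fun v w => o.repr.inner_map_map _ _⟩

/-- Two linear maps that are formally adjoint to each other on a subspace (the range of `ρ`) extend
to an operator and its adjoint. -/
theorem exists_linearMap_extend_adjoint {F : Type*} [RCLike F] {E M : Type*}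
    [NormedAddCommGroup E] [InnerProductSpace F E] [FiniteDimensional F E]
    [AddCommGroup M] [Module F M] (ρ t s : M →ₗ[F] E)
    (ht : ∀ m, ρ m = 0 → t m = 0) (hs : ∀ m, ρ m = 0 → s m = 0)
    (hts : ∀ m m', inner F (t m) (ρ m') = inner F (ρ m) (s m')) :
    ∃ X : E →ₗ[F] E, ∀ m, X (ρ m) = t m ∧ X.adjoint (ρ m) = s m := by
  have ext (t : M →ₗ[F] E) (ht : ∀ m, ρ m = 0 → t m = 0) :
      ∃ T : E →ₗ[F] E, ∀ m, T (ρ m) = t m := by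
    obtain ⟨T, hT⟩ := (((LinearMap.ker ρ).liftQ t fun m hm => ht m hm) ∘ₗ
      ρ.quotKerEquivRange.symm.toLinearMap).exists_extend
    refine ⟨T, fun m => ?_⟩
    have h := LinearMap.congr_fun hT ⟨ρ m, m, rfl⟩
    have h2 : ρ.quotKerEquivRange.symm ⟨ρ m, m, rfl⟩ = (LinearMap.ker ρ).mkQ m :=
      ρ.quotKerEquivRange_symm_apply_image m _
    exact h.trans (congrArg _ h2)
  obtain ⟨T, hT⟩ := ext t ht
  obtain ⟨S, hS⟩ := ext s hs
  let P : E →ₗ[F] E := (LinearMap.range ρ).starProjection.toLinearMap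
  have hP (m : M) : P (ρ m) = ρ m :=
    Submodule.starProjection_eq_self_iff.2 ⟨m, rfl⟩
  have hPP (v w : E) : inner F (P v) w = inner F v (P w) :=
    Submodule.inner_starProjection_left_eq_right _ v w
  have hrange (v : E) : ∃ m, ρ m = P v :=
    Submodule.starProjection_apply_mem (LinearMap.range ρ) v
  -- The adjoint is `P T* + (1 - P) S P`. On the range of `ρ`, `hts` gives `P T* = P S`, so the two
  -- terms add up to `S`.
  refine ⟨T ∘ₗ P + (S ∘ₗ P).adjoint ∘ₗ (LinearMap.id - P), fun m => ⟨?_, ?_⟩⟩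
  · simp [hP, hT]
  · refine ext_inner_right F fun w => ?_
    obtain ⟨m', hm'⟩ := hrange w
    rw [LinearMap.adjoint_inner_left]
    simp only [LinearMap.add_apply, LinearMap.comp_apply, LinearMap.sub_apply, LinearMap.id_apply,
      inner_add_right, LinearMap.adjoint_inner_right, hP, hS, inner_sub_right]
    rw [← hm', hT]
    have h := hts m' m
    rw [← inner_conj_symm, h, inner_conj_symm]
    ring

/-! ### The truncated GNS construction -/

/-- The functional separating a real left ideal from the squares of elements outside it. -/
theorem IsRealLeftIdeal.exists_functional {F : Type*} [RCLike F] {A : Type*} [Ring A]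
    [Algebra F A] [Module ℝ A] [IsScalarTower ℝ F A] [StarRing A] [StarModule F A]
    {J : Ideal A} (hJ : IsRealLeftIdeal J) (W : Submodule F A) [FiniteDimensional F W] :
    ∃ L : A →ₗ[F] F, (∀ a, L (star a) = star (L a)) ∧
      (∀ a ∈ J, RCLike.re (L (star a * a)) = 0) ∧
      ∀ a ∈ W, a ∉ J → 0 < RCLike.re (L (star a * a)) := by
  have hsmul (r : ℝ) (a : A) : r • a = (r : F) • a := by
    rw [← algebraMap_smul F r a, RCLike.algebraMap_eq_ofReal]
  have hstar (r : ℝ) (a : A) : star (r • a) = r • star a := by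
    rw [hsmul, hsmul r (star a), star_smul, RCLike.star_def, RCLike.conj_ofReal]
  have hJs (r : ℝ) {a : A} (ha : a ∈ J) : r • a ∈ J := by
    rw [hsmul, ← one_mul a, ← smul_mul_assoc]
    exact J.mul_mem_left _ ha
  let N : Submodule ℝ A :=
    { carrier := {a | ∃ b ∈ J, ∃ c ∈ J, a = b + star c}
      zero_mem' := ⟨0, J.zero_mem, 0, J.zero_mem, by simp⟩
      add_mem' := by
        rintro _ _ ⟨b, hb, c, hc, rfl⟩ ⟨b', hb', c', hc', rfl⟩
        exact ⟨b + b', J.add_mem hb hb', c + c', J.add_mem hc hc', by rw [star_add]; abel⟩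
      smul_mem' := by
        rintro r _ ⟨b, hb, c, hc, rfl⟩
        exact ⟨r • b, hJs r hb, r • c, hJs r hc, by rw [smul_add, hstar]⟩ }
  have hN1 (a : A) (ha : a ∈ J) : N.mkQ a = 0 :=
    (Submodule.Quotient.mk_eq_zero N).2 ⟨a, ha, 0, J.zero_mem, by simp⟩
  have hN2 (a : A) (ha : a ∈ J) : N.mkQ (star a) = 0 :=
    (Submodule.Quotient.mk_eq_zero N).2 ⟨0, J.zero_mem, a, ha, by simp⟩
  let b : W →ₗ[ℝ] W →ₗ[ℝ] A ⧸ N := LinearMap.mk₂ ℝ (fun p q => N.mkQ (star (p : A) * q))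
    (fun p p' q => by simp [add_mul])
    (fun r p q => by
      rw [← map_smul, Submodule.coe_smul_of_tower, hstar, hsmul, hsmul, smul_mul_assoc])
    (fun p q q' => by simp [mul_add])
    (fun r p q => by
      rw [← map_smul, Submodule.coe_smul_of_tower, hsmul, hsmul, mul_smul_comm])
  let K : Submodule ℝ W :=
    { carrier := {p | (p : A) ∈ J}
      zero_mem' := J.zero_mem
      add_mem' := fun hp hq => J.add_mem hp hq
      smul_mem' := fun r p hp => by
        simpa only [Set.mem_ofPred_eq, Submodule.coe_smul_of_tower] using hJs r hp }
  have : FiniteDimensional ℝ W := Module.Finite.trans F W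
  obtain ⟨L, hL⟩ := exists_dual_pos_of_sum_ne_zero b K
    (fun n hn w => by
      have := hN2 _ (J.mul_mem_left (star (w : A)) hn)
      rwa [star_mul, star_star] at this)
    (fun n hn w => hN1 _ (J.mul_mem_left _ hn))
    (fun r v h i => by
      have h1 : N.mkQ (∑ i, star (v i : A) * (v i : A)) = 0 := by
        rw [map_sum]; exact h
      obtain ⟨b, hb, c, hc, h2⟩ := (Submodule.Quotient.mk_eq_zero N).1 h1
      exact hJ r (fun i => v i) ⟨b, hb, c, hc, h2⟩ i)
  -- Symmetrizing makes the extension to `F` hermitian and merely doubles the value on the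
  -- self-adjoint elements `a* a`.
  let L₁ : A →ₗ[ℝ] ℝ :=
    { toFun := fun a => L (N.mkQ a) + L (N.mkQ (star a))
      map_add' := fun a a' => by simp only [star_add, map_add]; ring
      map_smul' := fun r a => by simp only [hstar, map_smul, RingHom.id_apply, smul_add] }
  have hL₁ (a : A) : L₁ a = L (N.mkQ a) + L (N.mkQ (star a)) := rfl
  have hL₁s (a : A) : L₁ (star a) = L₁ a := by rw [hL₁, hL₁, star_star, add_comm]
  refine ⟨Module.Dual.extendRCLike (𝕜 := F) L₁, fun a => ?_, fun a ha => ?_, fun a ha haJ => ?_⟩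
  · have h : L₁ ((RCLike.I : F) • star a) = - L₁ ((RCLike.I : F) • a) := by
      rw [← hL₁s, star_smul, star_star, ← map_neg, ← neg_smul]
      simp
    apply RCLike.ext
    · simp [hL₁s]
    · simp [h]
  · rw [Module.Dual.re_extendRCLike_apply, hL₁, star_mul, star_star,
      hN1 _ (J.mul_mem_left _ ha)]
    simp
  · have h := hL ⟨a, ha⟩ haJ
    rw [Module.Dual.re_extendRCLike_apply, hL₁, star_mul, star_star]
    exact add_pos h h

/-- The Gelfand-Naimark-Segal map of a real left ideal on a finite-dimensional subspace. -/
theorem IsRealLeftIdeal.exists_linearMap_euclidean {F : Type*} [RCLike F] {A : Type*} [Ring A]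
    [Algebra F A] [Module ℝ A] [IsScalarTower ℝ F A] [StarRing A] [StarModule F A]
    {J : Ideal A} (hJ : IsRealLeftIdeal J) (W : Submodule F A) [FiniteDimensional F W] :
    ∃ (L : A →ₗ[F] F) (n : ℕ) (ρ : W →ₗ[F] EuclideanSpace F (ULift.{u} (Fin n))),
      (∀ p q : W, inner F (ρ p) (ρ q) = L (star (p : A) * q)) ∧
      ∀ p : W, ρ p = 0 ↔ (p : A) ∈ J := by
  obtain ⟨L, hs, h0, hpos⟩ := hJ.exists_functional W
  have hnn (p : W) : 0 ≤ RCLike.re (L (star (p : A) * p)) := by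
    by_cases hp : (p : A) ∈ J
    · exact (h0 p hp).ge
    · exact (hpos p p.2 hp).le
  let c : PreInnerProductSpace.Core F W :=
    { inner := fun p q => L (star (p : A) * q)
      conj_inner_symm := fun p q => by
        rw [← RCLike.star_def, ← hs, star_mul, star_star]
      re_inner_nonneg := hnn
      add_left := fun p q r => by simp [add_mul]
      smul_left := fun p q r => by simp [star_smul] }
  obtain ⟨n, ρ, hρ⟩ := c.exists_toEuclideanSpace
  refine ⟨L, n, ρ, hρ, fun p => ?_⟩
  have h : RCLike.re (L (star (p : A) * p)) = ‖ρ p‖ ^ 2 := by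
    rw [← inner_self_eq_norm_sq (𝕜 := F), hρ]
    rfl
  constructor
  · intro hp
    by_contra hpJ
    have := hpos p p.2 hpJ
    simp [h, hp] at this
  · intro hp
    rw [h0 p hp] at h
    simpa using h.symm

/-! ### Finite-dimensional points of the free algebra -/

namespace FreeStarAlgebra

variable {F : Type*} [RCLike F] {g : ℕ}

variable (F g) in
/-- The space of all elements of degree at most `k`. -/
noncomputable def degLE (k : ℕ) : Submodule F (FreeStarAlgebra F g) :=
  Submodule.span F ((fun w => MonoidAlgebra.single w 1) '' {w : StarWord g | w.length ≤ k})

theorem single_mem_degLE {k : ℕ} {w : StarWord g} (hw : w.length ≤ k) (c : F) :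
    MonoidAlgebra.single w c ∈ degLE F g k := by
  have := (degLE F g k).smul_mem c (Submodule.subset_span ⟨w, hw, rfl⟩)
  simpa [MonoidAlgebra.smul_single] using this

instance finiteDimensional_degLE (k : ℕ) : FiniteDimensional F (degLE F g k) :=
  FiniteDimensional.span_of_finite F
    (((List.finite_length_le (Fin g ⊕ Fin g) k).subset fun _ h => h).image _)

theorem degLE_mono {k l : ℕ} (h : k ≤ l) : degLE F g k ≤ degLE F g l :=
  Submodule.span_mono (Set.image_mono fun _ hw => le_trans hw h)

theorem exists_mem_degLE (a : FreeStarAlgebra F g) : ∃ k, a ∈ degLE F g k := by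
  induction a using MonoidAlgebra.induction_linear with
  | zero => exact ⟨0, Submodule.zero_mem _⟩
  | add p q hp hq =>
    obtain ⟨k, hk⟩ := hp
    obtain ⟨l, hl⟩ := hq
    exact ⟨max k l, Submodule.add_mem _ (degLE_mono (le_max_left k l) hk)
      (degLE_mono (le_max_right k l) hl)⟩
  | single w c => exact ⟨_, single_mem_degLE le_rfl c⟩

theorem exists_subset_degLE (s : Finset (FreeStarAlgebra F g)) :
    ∃ k, ∀ a ∈ s, a ∈ degLE F g k := by
  choose k hk using exists_mem_degLE (F := F) (g := g)
  exact ⟨s.sup k, fun a ha => degLE_mono (Finset.le_sup ha) (hk a)⟩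

theorem single_mul_mem_degLE {k : ℕ} (l : Fin g ⊕ Fin g) {a : FreeStarAlgebra F g}
    (ha : a ∈ degLE F g k) :
    MonoidAlgebra.single (FreeMonoid.of l) 1 * a ∈ degLE F g (k + 1) := by
  induction ha using Submodule.span_induction with
  | mem x hx =>
    obtain ⟨w, hw, rfl⟩ := hx
    rw [MonoidAlgebra.single_mul_single]
    refine single_mem_degLE ?_ _
    rw [FreeMonoid.length_mul, FreeMonoid.length_of, add_comm]
    exact Nat.succ_le_succ hw
  | zero => simp
  | add x y _ _ hx hy => rw [mul_add]; exact Submodule.add_mem _ hx hy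
  | smul c x _ hx => rw [mul_smul_comm]; exact Submodule.smul_mem _ c hx

/-- The operators by which the letters act, given those of the `x_j`. -/
noncomputable def letterEnd {E : Type*} [NormedAddCommGroup E] [InnerProductSpace F E]
    [FiniteDimensional F E] (X : Fin g → Module.End F E) : Fin g ⊕ Fin g → Module.End F E :=
  Sum.elim X fun j => LinearMap.adjoint (X j)

theorem adjoint_letterEnd {E : Type*} [NormedAddCommGroup E] [InnerProductSpace F E]
    [FiniteDimensional F E] (X : Fin g → Module.End F E) (l : Fin g ⊕ Fin g) :
    LinearMap.adjoint (letterEnd X l) = letterEnd X l.swap := by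
  cases l <;> simp [letterEnd]

/-- Evaluation at a tuple of operators and their adjoints. -/
noncomputable def evalEnd {E : Type*} [NormedAddCommGroup E] [InnerProductSpace F E]
    [FiniteDimensional F E] (X : Fin g → Module.End F E) :
    FreeStarAlgebra F g →ₐ[F] Module.End F E :=
  MonoidAlgebra.lift F (Module.End F E) (StarWord g) (FreeMonoid.lift (letterEnd X))

theorem evalEnd_single {E : Type*} [NormedAddCommGroup E] [InnerProductSpace F E]
    [FiniteDimensional F E] (X : Fin g → Module.End F E) (w : StarWord g) (c : F) :
    evalEnd X (MonoidAlgebra.single w c) = c • FreeMonoid.lift (letterEnd X) w :=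
  MonoidAlgebra.lift_single _ _ _

/-- The `*`-representation on a finite-dimensional space in which `x_j` acts as `X j`. -/
noncomputable def repOfEnd {E : Type u} [NormedAddCommGroup E] [InnerProductSpace F E]
    [FiniteDimensional F E] (X : Fin g → Module.End F E) :
    StarRep.{u} F (FreeStarAlgebra F g) where
  V := E
  toAlgHom := evalEnd X
  inner_apply_left a v w := by
    have hword (u : StarWord g) (v w : E) :
        inner F (FreeMonoid.lift (letterEnd X) u v) w
          = inner F v (FreeMonoid.lift (letterEnd X) u.inv w) := by
      induction u using FreeMonoid.inductionOn generalizing v w with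
      | one => simp [StarWord.inv_one]
      | of l =>
        rw [StarWord.inv_of, FreeMonoid.lift_eval_of, FreeMonoid.lift_eval_of,
          ← adjoint_letterEnd, LinearMap.adjoint_inner_right]
      | mul x y hx hy =>
        rw [StarWord.inv_mul, map_mul, map_mul, Module.End.mul_apply, Module.End.mul_apply,
          hx, hy]
    induction a using MonoidAlgebra.induction_linear with
    | zero => simp
    | add p q hp hq =>
      simp only [star_add, map_add, LinearMap.add_apply, inner_add_left, inner_add_right, hp, hq]
    | single u c =>
      simp [star_single, evalEnd_single, inner_smul_left, inner_smul_right, hword]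

/-- For every real left ideal `J` and every degree there is a finite-dimensional point that
annihilates exactly those elements of bounded degree that lie in `J`. -/
theorem exists_point_of_isRealLeftIdeal {F : Type} [RCLike F] {J : Ideal (FreeStarAlgebra F g)}
    (hJ : IsRealLeftIdeal J) (k : ℕ) :
    ∃ (π : StarRep.{u} F (FreeStarAlgebra F g)) (v : π.V), FiniteDimensional F π.V ∧
      ∀ a ∈ degLE F g (k + 1), π.toAlgHom a v = 0 ↔ a ∈ J := by
  obtain ⟨L, n, ρ, hρ, hρ0⟩ := hJ.exists_linearMap_euclidean.{u} (degLE F g (k + 1))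
  let ι : degLE F g k →ₗ[F] degLE F g (k + 1) := Submodule.inclusion (degLE_mono k.le_succ)
  let m (l : Fin g ⊕ Fin g) : degLE F g k →ₗ[F] degLE F g (k + 1) :=
    (LinearMap.mulLeft F (MonoidAlgebra.single (FreeMonoid.of l) 1)).restrict
      fun a ha => single_mul_mem_degLE l ha
  have hm (l a) : (m l a : FreeStarAlgebra F g)
      = MonoidAlgebra.single (FreeMonoid.of l) 1 * (a : FreeStarAlgebra F g) := rfl
  have hm0 (l a) (h : ρ (ι a) = 0) : ρ (m l a) = 0 := by
    rw [hρ0] at h ⊢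
    exact J.mul_mem_left _ h
  -- Formal adjointness holds because both inner products equal `L (a* x_j* a')`.
  have hX (j : Fin g) := exists_linearMap_extend_adjoint (ρ ∘ₗ ι) (ρ ∘ₗ m (Sum.inl j))
    (ρ ∘ₗ m (Sum.inr j)) (hm0 _) (hm0 _) (fun a a' => by
      simp only [LinearMap.comp_apply, hρ, hm, star_mul, star_single, StarWord.inv_of, star_one,
        Sum.swap_inl, mul_assoc]
      rfl)
  choose X hX using hX
  have hletter (l : Fin g ⊕ Fin g) (a : degLE F g k) : letterEnd X l (ρ (ι a)) = ρ (m l a) := by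
    cases l with
    | inl j => exact (hX j a).1
    | inr j => exact (hX j a).2
  let v₀ := ρ ⟨1, single_mem_degLE (Nat.zero_le _) 1⟩
  -- Length `k + 1` is reachable: the last letter applied acts on a word of length at most `k`,
  -- where `hletter` holds.
  have hword (w : StarWord g) (hw : w.length ≤ k + 1) :
      FreeMonoid.lift (letterEnd X) w v₀ = ρ ⟨_, single_mem_degLE hw 1⟩ := by
    induction w using FreeMonoid.inductionOn' with
    | one => simp [v₀, MonoidAlgebra.one_def]
    | of_mul l w ih =>
      rw [FreeMonoid.length_mul, FreeMonoid.length_of, add_comm] at hw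
      have hw' : w.length ≤ k := Nat.le_of_succ_le_succ hw
      rw [map_mul, Module.End.mul_apply, ih (hw'.trans k.le_succ), FreeMonoid.lift_eval_of]
      refine (hletter l ⟨_, single_mem_degLE hw' 1⟩).trans (congrArg ρ (Subtype.ext ?_))
      simp [hm, MonoidAlgebra.single_mul_single]
  have heval (a) (ha : a ∈ degLE F g (k + 1)) : evalEnd X a v₀ = ρ ⟨a, ha⟩ := by
    induction ha using Submodule.span_induction with
    | mem x hx =>
      obtain ⟨w, hw, rfl⟩ := hx
      rw [evalEnd_single, one_smul, hword w hw]
    | zero => rw [map_zero]; exact (map_zero ρ).symm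
    | add x y hx hy ihx ihy =>
      rw [map_add, LinearMap.add_apply, ihx, ihy]
      exact (map_add ρ _ _).symm
    | smul c x hx ih =>
      rw [map_smul, LinearMap.smul_apply, ih]
      exact (map_smul ρ c _).symm
  refine ⟨repOfEnd X, v₀, inferInstanceAs (FiniteDimensional F (EuclideanSpace F _)),
    fun a ha => ?_⟩
  have h : evalEnd X a v₀ = 0 ↔ a ∈ J := by rw [heval a ha, hρ0]
  exact h

end FreeStarAlgebra

/-! ### Comparison of the radicals -/

/-- Vanishing ideals of sets of points are real. -/
theorem isRealLeftIdeal_vanishingIdeal {F : Type*} [RCLike F] {A : Type*} [Ring A] [Algebra F A]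
    [StarRing A] (T : Set (Σ π : StarRep.{u} F A, π.V)) :
    IsRealLeftIdeal (vanishingIdeal T) := by
  rintro r a ⟨b, hb, c, hc, h⟩ i P hP
  have h1 : ∑ i, inner F (P.1.toAlgHom (a i) P.2) (P.1.toAlgHom (a i) P.2) = 0 := by
    have h2 := congrArg (fun x => inner F P.2 (P.1.toAlgHom x P.2)) h
    simp only [map_add, map_sum, LinearMap.add_apply, LinearMap.sum_apply, inner_add_right,
      inner_sum, map_mul, Module.End.mul_apply, ← P.1.inner_apply_left] at h2
    rw [h2, hb P hP, hc P hP]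
    simp
  have h2 : ∑ i, ‖P.1.toAlgHom (a i) P.2‖ ^ 2 = 0 := by
    have := congrArg RCLike.re h1
    simpa only [map_sum, inner_self_eq_norm_sq, map_zero] using this
  have h3 := (Finset.sum_eq_zero_iff_of_nonneg fun i _ => sq_nonneg _).1 h2 i (Finset.mem_univ i)
  simpa using h3

theorem le_repRadical {F : Type*} [RCLike F] {A : Type*} [Ring A] [Algebra F A] [StarRing A]
    (C : Set (StarRep.{u} F A)) (I : Ideal A) : I ≤ repRadical C I :=
  fun a ha _ hP => hP.2 a ha

theorem realRadical_le_repRadical {F : Type*} [RCLike F] {A : Type*} [Ring A] [Algebra F A]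
    [StarRing A] (C : Set (StarRep.{u} F A)) (I : Ideal A) : realRadical I ≤ repRadical C I :=
  sInf_le ⟨le_repRadical C I, isRealLeftIdeal_vanishingIdeal _⟩

theorem repRadical_anti {F : Type*} [RCLike F] {A : Type*} [Ring A] [Algebra F A]
    [StarRing A] {C D : Set (StarRep.{u} F A)} (h : C ⊆ D) (I : Ideal A) :
    repRadical D I ≤ repRadical C I :=
  fun _ ha P hP => ha P ⟨h hP.1, hP.2⟩

theorem FreeStarAlgebra.repRadical_finDimReps_le {F : Type} [RCLike F] {g : ℕ}
    {I : Ideal (FreeStarAlgebra F g)} (hI : I.FG) :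
    repRadical (finDimReps.{u} F (FreeStarAlgebra F g)) I ≤ realRadical I := by
  classical
  intro a ha
  obtain ⟨s, rfl⟩ := hI
  obtain ⟨k, hk⟩ := exists_subset_degLE (insert a s)
  obtain ⟨π, v, hπ, hv⟩ := exists_point_of_isRealLeftIdeal.{u}
    (isLeast_realRadical (Ideal.span (s : Set (FreeStarAlgebra F g)))).1.2 k
  have hdeg (b) (hb : b ∈ insert a s) := degLE_mono k.le_succ (hk b hb)
  refine (hv a (hdeg a (Finset.mem_insert_self a s))).1 (ha ⟨π, v⟩ ⟨hπ, ?_⟩)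
  -- The point controls `J` only in bounded degree. Annihilating the generators is enough, since the
  -- annihilator of a vector is a left ideal.
  suffices h : Ideal.span (s : Set (FreeStarAlgebra F g)) ≤ vanishingIdeal {⟨π, v⟩} from
    fun b hb => h hb _ rfl
  refine Ideal.span_le.2 fun b hb => ?_
  rintro _ rfl
  exact (hv b (hdeg b (Finset.mem_insert_of_mem hb))).2
    ((isLeast_realRadical _).1.1 (Ideal.subset_span hb))

theorem mainTheorem1 {F : Type} [RCLike F] (g : ℕ)
    (I : Ideal (FreeStarAlgebra F g)) (hI : I.FG) :
    (HasLeftNullstellensatz (finDimReps.{u} F (FreeStarAlgebra F g)) I ↔ IsRealLeftIdeal I) ∧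
      I ≤ realRadical I ∧
      realRadical I = repRadical (allReps.{u} F (FreeStarAlgebra F g)) I ∧
      repRadical (allReps.{u} F (FreeStarAlgebra F g)) I
        = repRadical (finDimReps.{u} F (FreeStarAlgebra F g)) I := by
  have h1 := realRadical_le_repRadical (allReps.{u} F (FreeStarAlgebra F g)) I
  have h2 := repRadical_anti (Set.subset_univ (finDimReps.{u} F (FreeStarAlgebra F g))) I
  have h3 := FreeStarAlgebra.repRadical_finDimReps_le.{u} hI
  refine ⟨⟨fun h => h ▸ isRealLeftIdeal_vanishingIdeal _, fun h => ?_⟩,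
    (isLeast_realRadical I).1.1, le_antisymm h1 (h2.trans h3), le_antisymm h2 (h3.trans h1)⟩
  exact le_antisymm (h3.trans ((isLeast_realRadical I).2 ⟨le_rfl, h⟩)) (le_repRadical _ I)
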